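/- Let $\omega$ be a non-principal ultrafilter on $\mathbb N$ and let $(n_k)_k$ be an increasing, unbounded sequence of positive integers. The universal sofic group $\Pi_{k\to\omega}Sym(n_k)$ is the quotient of $\prod_k Sym(n_k)$ by the normal subgroup of those $(p_k)_k$ with $\lim_{k\to\omega}\frac1{n_k}Card\{i: p_k(i)\neq i\}=0$. Let $X_\omega$ be the set-theoretic ultraproduct of the sets $\{1,\dots,n_k\}$ along $\omega$, and let $\mu_\omega$ be the Loeb measure on it, that is, the Carathéodory extension of $\mu_\omega(\Pi_{k\to\omega}A_k)=\lim_{k\to\omega}Card(A_k)/n_k$, $A_k\subset\{1,\dots,n_k\}$. An element $p=\Pi_{k\to\omega}p_k$ of the universal sofic group acts on $X_\omega$, up to null sets, by $p((x_k)_k)=(p_k(x_k))_k$. Let $St:X_\omega\to[0,1]$, $St((x_k)_k)=\lim_{k\to\omega}x_k/n_k$. Let $X=[0,1]$ with the Lebesgue measure $\mu$, and let $Aut(X,\mu)$ be the group of bijections of $X$ that are Lebesgue measurable and measure preserving together with their inverse, two of them being identified if they agree $\mu$-almost everywhere. For $p\in\Pi_{k\to\omega}Sym(n_k)$ and $\varphi:X\to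 X$ write $p|_X=\varphi$ if $St(p(x))=\varphi(St(x))$ for $\mu_\omega$-almost all $x\in X_\omega$. Let $\mathcal{GA}$ be the subgroup of those $p$ for which there is an automorphism $\varphi$ of $(X,\mu)$ with $p|_X=\varphi$. For $p\in Sym(n)$ let $\ell_C(p)=\frac{2}{n(n-1)}Card\{i<j:p(i)>p(j)\}$ (and $\ell_C(p)=0$ if $n=1$), put $\ell_C(\Pi_{k\to\omega}p_k)=\lim_{k\to\omega}\ell_C(p_k)$, and let $\ell_0$ be the subgroup of those $p\in\Pi_{k\to\omega}Sym(n_k)$ with $\ell_C(p)=0$. Theorem. There is a short exact sequence of groups $$0\to\ell_0\to\mathcal{GA}\to Aut(X,\mu)\to 0,$$ where the maps are the inclusion and the restriction. That is: $\ell_0\subset\mathcal{GA}$; there is a group homomorphism $\Psi:\mathcal{GA}\to Aut(X,\mu)$ such that, for every $p\in\mathcal{GA}$ and every automorphism $\varphi$ of $(X,\mu)$, $\Psi(p)$ is the class of $\varphi$ if and only if $p|_X=\varphi$; $\Psi$ is surjective; and the kernel of $\Psi$ is exactly $\ell_0$. -/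

import Mathlib

open Filter Topology MeasureTheory
open scoped ENNReal unitInterval

noncomputable section

namespace Sofic

/-- The limit of a sequence along the ultrafilter `ω`. -/
def ulim {Y : Type*} [TopologicalSpace Y] [Nonempty Y] (ω : Ultrafilter ℕ) (u : ℕ → Y) : Y :=
  limUnder (ω : Filter ℕ) u

theorem tendsto_ulim {Y : Type*} [TopologicalSpace Y] [CompactSpace Y] [Nonempty Y]
    (ω : Ultrafilter ℕ) (u : ℕ → Y) : Tendsto u ω (𝓝 (ulim ω u)) := by
  apply tendsto_nhds_limUnder
  obtain ⟨y, -, hy⟩ := isCompact_univ.ultrafilter_le_nhds (ω.map u) (by simp)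
  exact ⟨y, hy⟩

theorem tendsto_ulim_real (ω : Ultrafilter ℕ) (u : ℕ → ℝ) (C : ℝ)
    (hu : ∀ k, u k ∈ Set.Icc 0 C) : Tendsto u ω (𝓝 (ulim ω u)) := by
  apply tendsto_nhds_limUnder
  obtain ⟨y, -, hy⟩ := (isCompact_Icc (a := (0 : ℝ)) (b := C)).ultrafilter_le_nhds (ω.map u)
    (by
      rw [le_principal_iff]
      exact Eventually.of_forall (f := (ω : Filter ℕ)) hu)
  exact ⟨y, hy⟩

theorem ulim_eq {Y : Type*} [TopologicalSpace Y] [T2Space Y] [Nonempty Y]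
    {ω : Ultrafilter ℕ} {u : ℕ → Y} {y : Y} (h : Tendsto u ω (𝓝 y)) : ulim ω u = y :=
  tendsto_nhds_unique (tendsto_nhds_limUnder ⟨y, h⟩) h

/-! ### The universal sofic group -/

/-- The normalised Hamming length of a permutation. -/
def hammingLength {m : ℕ} (p : Equiv.Perm (Fin m)) : ℝ :=
  (p.support.card : ℝ) / m

/-- The sequences of permutations whose Hamming length tends to `0` along `ω`. -/
def hammingNull (ω : Ultrafilter ℕ) (n : ℕ → ℕ) : Subgroup (∀ k, Equiv.Perm (Fin (n k))) where
  carrier := {p | Tendsto (fun k => hammingLength (p k)) ω (𝓝 0)}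
  one_mem' := by simp [hammingLength]
  mul_mem' := by
    intro p q hp hq
    have h := Tendsto.add hp hq
    rw [add_zero] at h
    refine squeeze_zero (fun k => ?_) (fun k => ?_) h
    · unfold hammingLength; positivity
    · simp only [hammingLength, Pi.mul_apply]
      rw [← add_div]
      gcongr
      exact_mod_cast (Finset.card_le_card (Equiv.Perm.support_mul_le (p k) (q k))).trans
        (Finset.card_union_le _ _)
  inv_mem' := by
    intro p hp
    simpa [hammingLength] using hp

instance (ω : Ultrafilter ℕ) (n : ℕ → ℕ) : (hammingNull ω n).Normal where
  conj_mem p hp g := by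
    change Tendsto _ _ _
    have h : Tendsto (fun k => hammingLength (p k)) ω (𝓝 0) := hp
    refine h.congr fun k => ?_
    simp [hammingLength]

/-- The universal sofic group `Π_{k → ω} Sym(n_k)`: the metric ultraproduct of the symmetric
groups with respect to the Hamming distance. -/
abbrev UniversalSoficGroup (ω : Ultrafilter ℕ) (n : ℕ → ℕ) : Type :=
  (∀ k, Equiv.Perm (Fin (n k))) ⧸ hammingNull ω n

/-! ### The Loeb space -/

/-- The underlying set of the Loeb space: the algebraic ultraproduct of the sets
`{1, …, n_k}`, where `i : Fin (n k)` stands for the number `i + 1`. -/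
abbrev LoebSpace (ω : Ultrafilter ℕ) (n : ℕ → ℕ) : Type :=
  (ω : Filter ℕ).Product fun k => Fin (n k)

variable {ω : Ultrafilter ℕ} {n : ℕ → ℕ}

/-- The internal set `Π_{k → ω} A_k`. -/
def internalSet (ω : Ultrafilter ℕ) {n : ℕ → ℕ} (A : ∀ k, Finset (Fin (n k))) :
    Set (LoebSpace ω n) :=
  {x | Quotient.liftOn x (fun a => ∀ᶠ k in (ω : Filter ℕ), a k ∈ A k) fun _ _ h =>
    propext (eventually_congr (h.mono fun _ hk => by rw [hk]))}

/-- The limit of `Card(A_k) / n_k` along `ω`. -/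
def internalSize (ω : Ultrafilter ℕ) {n : ℕ → ℕ} (A : ∀ k, Finset (Fin (n k))) : ℝ≥0∞ :=
  ulim ω fun k => ((A k).card : ℝ≥0∞) / (n k : ℝ≥0∞)

/-- The pre-measure on internal sets, `Π_{k → ω} A_k ↦ lim_{k → ω} Card(A_k) / n_k`, extended by
`∞` to the other sets. -/
def loebPre (ω : Ultrafilter ℕ) (n : ℕ → ℕ) (S : Set (LoebSpace ω n)) : ℝ≥0∞ :=
  ⨅ (A : ∀ k, Finset (Fin (n k))) (_ : internalSet ω A = S), internalSize ω A

theorem loebPre_internalSet_le (A : ∀ k, Finset (Fin (n k))) :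
    loebPre ω n (internalSet ω A) ≤ internalSize ω A :=
  iInf₂_le (f := fun (B : ∀ k, Finset (Fin (n k))) (_ : internalSet ω B = internalSet ω A) =>
    internalSize ω B) A rfl

theorem internalSize_tendsto (A : ∀ k, Finset (Fin (n k))) :
    Tendsto (fun k => ((A k).card : ℝ≥0∞) / (n k : ℝ≥0∞)) ω (𝓝 (internalSize ω A)) :=
  tendsto_ulim _ _

theorem loebPre_empty : loebPre ω n ∅ = 0 := by
  have h : internalSet ω (fun k => (∅ : Finset (Fin (n k)))) = ∅ := by
    ext x
    induction x using Quotient.inductionOn with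
    | h a =>
      change (∀ᶠ k in (ω : Filter ℕ), a k ∈ (∅ : Finset (Fin (n k)))) ↔ False
      simpa using ω.neBot.ne
  have h' := loebPre_internalSet_le (ω := ω) (fun k => (∅ : Finset (Fin (n k))))
  rw [h] at h'
  refine le_antisymm (h'.trans_eq ?_) bot_le
  exact ulim_eq (by simp)

/-- The outer measure on the Loeb space induced by the pre-measure on internal sets. -/
def loebOuter (ω : Ultrafilter ℕ) (n : ℕ → ℕ) : OuterMeasure (LoebSpace ω n) :=
  OuterMeasure.ofFunction (loebPre ω n) loebPre_empty

/-- The σ-algebra generated by the internal sets. -/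
instance loebMeasurableSpace (ω : Ultrafilter ℕ) (n : ℕ → ℕ) : MeasurableSpace (LoebSpace ω n) :=
  MeasurableSpace.generateFrom (Set.range (internalSet ω))

theorem loebMeasurableSpace_le (ω : Ultrafilter ℕ) (n : ℕ → ℕ) :
    loebMeasurableSpace ω n ≤ (loebOuter ω n).caratheodory := by
  refine MeasurableSpace.generateFrom_le ?_
  rintro _ ⟨B, rfl⟩
  refine OuterMeasure.ofFunction_caratheodory fun t => ?_
  refine le_iInf₂ fun A hA => ?_
  subst hA
  have h1 : internalSet ω A ∩ internalSet ω B = internalSet ω (fun k => A k ∩ B k) := by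
    ext x
    induction x using Quotient.inductionOn with
    | h a =>
      change ((∀ᶠ k in (ω : Filter ℕ), a k ∈ A k) ∧ ∀ᶠ k in (ω : Filter ℕ), a k ∈ B k) ↔
        ∀ᶠ k in (ω : Filter ℕ), a k ∈ A k ∩ B k
      simp only [Finset.mem_inter, eventually_and]
  have h2 : internalSet ω A \ internalSet ω B = internalSet ω (fun k => A k \ B k) := by
    ext x
    induction x using Quotient.inductionOn with
    | h a =>
      change ((∀ᶠ k in (ω : Filter ℕ), a k ∈ A k) ∧ ¬ ∀ᶠ k in (ω : Filter ℕ), a k ∈ B k) ↔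
        ∀ᶠ k in (ω : Filter ℕ), a k ∈ A k \ B k
      simp only [Finset.mem_sdiff, eventually_and, Ultrafilter.eventually_not]
  rw [h1, h2]
  refine (add_le_add (loebPre_internalSet_le _) (loebPre_internalSet_le _)).trans_eq ?_
  refine tendsto_nhds_unique ((internalSize_tendsto _).add (internalSize_tendsto _)) ?_
  refine (internalSize_tendsto A).congr fun k => ?_
  rw [← ENNReal.add_div]
  congr 1
  exact_mod_cast (Finset.card_inter_add_card_sdiff (A k) (B k)).symm

/-- The Loeb measure `μ_ω`, obtained by Carathéodory extension. (Passing to the completed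
σ-algebra changes neither the null sets nor the meaning of "almost all", `∀ᵐ`.) -/
def loebMeasure (ω : Ultrafilter ℕ) (n : ℕ → ℕ) : Measure (LoebSpace ω n) :=
  (loebOuter ω n).toMeasure (loebMeasurableSpace_le ω n)

theorem measurableSet_internalSet (A : ∀ k, Finset (Fin (n k))) :
    MeasurableSet (internalSet ω A) :=
  MeasurableSpace.measurableSet_generateFrom ⟨A, rfl⟩

theorem loebMeasure_internalSet_le (A : ∀ k, Finset (Fin (n k))) :
    loebMeasure ω n (internalSet ω A) ≤ internalSize ω A := by
  rw [loebMeasure, toMeasure_apply _ _ (measurableSet_internalSet A)]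
  exact (OuterMeasure.ofFunction_le _).trans (loebPre_internalSet_le A)

/-- The standard part `(x_k)_k ↦ lim_{k → ω} x_k / n_k`. -/
def St (ω : Ultrafilter ℕ) (n : ℕ → ℕ) (x : LoebSpace ω n) : I :=
  Quotient.liftOn x
    (fun a => ulim ω fun k => (⟨((a k : ℕ) + 1 : ℝ) / (n k : ℝ), by
      have h : ((a k : ℕ) + 1 : ℝ) ≤ (n k : ℝ) := by exact_mod_cast (a k).isLt
      exact ⟨by positivity, div_le_one_of_le₀ h (by positivity)⟩⟩ : I))
    fun a b h => by
      refine congrArg lim (Filter.map_congr ?_)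
      exact Eventually.mono h fun k hk => by simp only [hk]

/-! ### The action on the Loeb space -/

/-- The map `(x_k)_k ↦ (p_k (x_k))_k` on the Loeb space. -/
def act (ω : Ultrafilter ℕ) (p : ∀ k, Equiv.Perm (Fin (n k))) (x : LoebSpace ω n) :
    LoebSpace ω n :=
  Quotient.map (fun (a : ∀ k, Fin (n k)) k => p k (a k))
    (fun _ _ h => Eventually.mono h fun k hk => congrArg (p k) hk) x

theorem act_mul (p q : ∀ k, Equiv.Perm (Fin (n k))) (x : LoebSpace ω n) :
    act ω (p * q) x = act ω p (act ω q x) := by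
  induction x using Quotient.inductionOn
  rfl

theorem act_one (x : LoebSpace ω n) : act ω (1 : ∀ k, Equiv.Perm (Fin (n k))) x = x := by
  induction x using Quotient.inductionOn
  rfl

theorem act_preimage_internalSet (p : ∀ k, Equiv.Perm (Fin (n k)))
    (A : ∀ k, Finset (Fin (n k))) :
    act ω p ⁻¹' internalSet ω A =
      internalSet ω (fun k => (A k).map (p k)⁻¹.toEmbedding) := by
  ext x
  induction x using Quotient.inductionOn with
  | h a =>
    change (∀ᶠ k in (ω : Filter ℕ), p k (a k) ∈ A k) ↔
      ∀ᶠ k in (ω : Filter ℕ), a k ∈ (A k).map (p k)⁻¹.toEmbedding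
    refine eventually_congr (Eventually.of_forall fun k => ?_)
    simp only [Finset.mem_map, Equiv.coe_toEmbedding]
    constructor
    · exact fun h => ⟨_, h, by simp⟩
    · rintro ⟨b, hb, h⟩
      rw [← h]
      simpa using hb

theorem measurable_act (p : ∀ k, Equiv.Perm (Fin (n k))) : Measurable (act ω p) := by
  refine measurable_generateFrom ?_
  rintro _ ⟨A, rfl⟩
  rw [act_preimage_internalSet]
  exact measurableSet_internalSet _

theorem loebOuter_preimage_act_le (p : ∀ k, Equiv.Perm (Fin (n k)))
    (s : Set (LoebSpace ω n)) : loebOuter ω n (act ω p ⁻¹' s) ≤ loebOuter ω n s := by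
  have h : OuterMeasure.map (act ω p) (loebOuter ω n) ≤ loebOuter ω n := by
    refine OuterMeasure.le_ofFunction.2 fun t => le_iInf₂ fun A hA => ?_
    subst hA
    rw [OuterMeasure.map_apply, act_preimage_internalSet]
    refine (OuterMeasure.ofFunction_le _).trans ((loebPre_internalSet_le _).trans_eq ?_)
    simp [internalSize]
  exact h s

theorem quasiMeasurePreserving_act (p : ∀ k, Equiv.Perm (Fin (n k))) :
    Measure.QuasiMeasurePreserving (act ω p) (loebMeasure ω n) (loebMeasure ω n) := by
  refine ⟨measurable_act p, Measure.AbsolutelyContinuous.mk fun s hs h => ?_⟩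
  rw [Measure.map_apply (measurable_act p) hs, loebMeasure,
    toMeasure_apply _ _ (measurable_act p hs)]
  rw [loebMeasure, toMeasure_apply _ _ hs] at h
  exact le_antisymm ((loebOuter_preimage_act_le p s).trans_eq h) bot_le

/-- Two sequences defining the same element of the universal sofic group act in the same way
almost everywhere. -/
theorem act_ae_eq {p q : ∀ k, Equiv.Perm (Fin (n k))} (h : p⁻¹ * q ∈ hammingNull ω n) :
    ∀ᵐ x ∂loebMeasure ω n, act ω p x = act ω q x := by
  let A : ∀ k, Finset (Fin (n k)) := fun k => ((p k)⁻¹ * q k).support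
  have h0 : internalSize ω A = 0 := by
    refine ulim_eq ?_
    have h' := ENNReal.tendsto_ofReal (show Tendsto _ _ _ from h)
    rw [ENNReal.ofReal_zero] at h'
    refine h'.congr fun k => ?_
    simp only [hammingLength, Pi.mul_apply, Pi.inv_apply]
    rcases Nat.eq_zero_or_pos (n k) with hn | hn
    · have : (A k).card = 0 := by
        have := (A k).card_le_univ
        simp at this
        omega
      simp only [A] at this ⊢
      simp [this]
    · rw [ENNReal.ofReal_div_of_pos (by exact_mod_cast hn)]
      simp [A]
  refine measure_mono_null ?_ (le_antisymm ((loebMeasure_internalSet_le A).trans_eq h0) bot_le)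
  intro x
  induction x using Quotient.inductionOn with
  | h a =>
    intro hx
    change ∀ᶠ k in (ω : Filter ℕ), a k ∈ A k
    by_contra hc
    rw [← Ultrafilter.eventually_not] at hc
    refine hx (Quotient.sound (hc.mono fun k hk => ?_))
    simp only [A, Equiv.Perm.mem_support, not_not, Equiv.Perm.mul_apply] at hk
    rw [Equiv.Perm.inv_eq_iff_eq] at hk
    exact hk.symm

/-- `RestrictsTo p φ` means `p|_X = φ`: one has `St (p x) = φ (St x)` for `μ_ω`-almost all `x`.
This does not depend on the sequence of permutations that represents `p`. -/
def RestrictsTo (p : UniversalSoficGroup ω n) (φ : I → I) : Prop :=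
  Quotient.liftOn' p
    (fun q => ∀ᵐ x ∂loebMeasure ω n, St ω n (act ω q x) = φ (St ω n x))
    fun q r h => by
      rw [QuotientGroup.leftRel_apply] at h
      refine propext (eventually_congr ((act_ae_eq h).mono fun x hx => ?_))
      rw [hx]

/-! ### Automorphisms of the unit interval and generalised automorphisms -/

/-- The bijections `T` of the unit interval such that `T` and `T⁻¹` are Lebesgue measurable and
preserve the Lebesgue measure. (`AEMeasurable` for the completed measure `volume` is the same as
measurability with respect to the Lebesgue σ-algebra.) -/
def measureAut : Subgroup (Equiv.Perm I) where
  carrier := {T | (AEMeasurable T volume ∧ Measure.map T volume = volume) ∧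
    (AEMeasurable (T⁻¹ : Equiv.Perm I) volume ∧
      Measure.map (T⁻¹ : Equiv.Perm I) volume = volume)}
  one_mem' := by
    refine ⟨⟨aemeasurable_id, Measure.map_id⟩, ?_⟩
    rw [inv_one]
    exact ⟨aemeasurable_id, Measure.map_id⟩
  mul_mem' := by
    have key : ∀ f g : I → I, (AEMeasurable f volume ∧ Measure.map f volume = volume) →
        (AEMeasurable g volume ∧ Measure.map g volume = volume) →
        (AEMeasurable (f ∘ g) volume ∧ Measure.map (f ∘ g) volume = volume) := by
      rintro f g ⟨hf, hf'⟩ ⟨hg, hg'⟩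
      have hf1 : AEMeasurable f (Measure.map g volume) := by rwa [hg']
      exact ⟨hf1.comp_aemeasurable hg, by
        rw [← AEMeasurable.map_map_of_aemeasurable hf1 hg, hg', hf']⟩
    rintro S T ⟨hS, hS'⟩ ⟨hT, hT'⟩
    refine ⟨key S T hS hT, ?_⟩
    rw [mul_inv_rev]
    exact key (T⁻¹ : Equiv.Perm I) (S⁻¹ : Equiv.Perm I) hT' hS'
  inv_mem' := by
    rintro T ⟨h, h'⟩
    exact ⟨h', by rwa [inv_inv]⟩

/-- The automorphisms that are almost everywhere equal to the identity. -/
def aeTrivial : Subgroup measureAut where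
  carrier := {T | ∀ᵐ x : I, (T : Equiv.Perm I) x = x}
  one_mem' := by simp
  mul_mem' := by
    intro S T hS hT
    filter_upwards [show ∀ᵐ x : I, (S : Equiv.Perm I) x = x from hS,
      show ∀ᵐ x : I, (T : Equiv.Perm I) x = x from hT] with x h1 h2
    simp [h1, h2]
  inv_mem' := by
    intro T hT
    filter_upwards [show ∀ᵐ x : I, (T : Equiv.Perm I) x = x from hT] with x h
    rw [Subgroup.coe_inv, Equiv.Perm.inv_eq_iff_eq, h]

instance : aeTrivial.Normal where
  conj_mem T hT S := by
    obtain ⟨-, h, h'⟩ := S.2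
    have hT' : ∀ᵐ x : I, (T : Equiv.Perm I) x = x := hT
    rw [← h'] at hT'
    filter_upwards [ae_of_ae_map h hT'] with x hx
    change (S : Equiv.Perm I) ((T : Equiv.Perm I) ((S : Equiv.Perm I)⁻¹ x)) = x
    rw [hx]
    exact Equiv.apply_symm_apply _ _

/-- The group `Aut(X, μ)` of automorphisms of the unit interval with the Lebesgue measure, where
automorphisms that agree almost everywhere are identified. -/
abbrev Aut : Type := measureAut ⧸ aeTrivial

/-- The group `𝒢𝒜` of generalised automorphisms: the elements `p` of the universal sofic group
such that `p|_X` exists and is an automorphism of `(X, μ)`. -/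
def GA (ω : Ultrafilter ℕ) (n : ℕ → ℕ) : Subgroup (UniversalSoficGroup ω n) where
  carrier := {p | ∃ T : measureAut, RestrictsTo p (T : Equiv.Perm I)}
  one_mem' := by
    refine ⟨1, Eventually.of_forall fun x => ?_⟩
    change St ω n (act ω 1 x) = St ω n x
    rw [act_one]
  mul_mem' := by
    intro p q
    induction p using QuotientGroup.induction_on with | H p =>
    induction q using QuotientGroup.induction_on with | H q =>
    rintro ⟨S, hS⟩ ⟨T, hT⟩
    refine ⟨S * T, ?_⟩
    change ∀ᵐ x ∂loebMeasure ω n, St ω n (act ω p x) = (S : Equiv.Perm I) (St ω n x) at hS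
    change ∀ᵐ x ∂loebMeasure ω n, St ω n (act ω q x) = (T : Equiv.Perm I) (St ω n x) at hT
    change ∀ᵐ x ∂loebMeasure ω n, St ω n (act ω (p * q) x) =
      (S : Equiv.Perm I) ((T : Equiv.Perm I) (St ω n x))
    filter_upwards [hT, (quasiMeasurePreserving_act q).ae hS] with x h1 h2
    rw [act_mul, h2, h1]
  inv_mem' := by
    intro p
    induction p using QuotientGroup.induction_on with | H p =>
    rintro ⟨T, hT⟩
    refine ⟨T⁻¹, ?_⟩
    change ∀ᵐ x ∂loebMeasure ω n, St ω n (act ω p x) = (T : Equiv.Perm I) (St ω n x) at hT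
    change ∀ᵐ x ∂loebMeasure ω n, St ω n (act ω p⁻¹ x) = (T : Equiv.Perm I)⁻¹ (St ω n x)
    filter_upwards [(quasiMeasurePreserving_act p⁻¹).ae hT] with x h
    rw [← act_mul, mul_inv_cancel, act_one] at h
    rw [h]
    exact (Equiv.symm_apply_apply _ _).symm

/-! ### The Coxeter semi-length -/

/-- The inversions of a permutation. -/
def inversions {m : ℕ} (p : Equiv.Perm (Fin m)) : Finset (Fin m × Fin m) :=
  Finset.univ.filter fun ij => ij.1 < ij.2 ∧ p ij.2 < p ij.1

theorem mem_inversions {m : ℕ} (p : Equiv.Perm (Fin m)) (i j : Fin m) :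
    (i, j) ∈ inversions p ↔ i < j ∧ p j < p i := by
  unfold inversions
  exact Finset.mem_filter_univ _

/-- The (normalised) Coxeter length `2 / (m (m - 1)) * Card {i < j : p i > p j}`. -/
def coxeterLength {m : ℕ} (p : Equiv.Perm (Fin m)) : ℝ :=
  2 / ((m : ℝ) * ((m : ℝ) - 1)) * ((inversions p).card : ℝ)

theorem coxeterFactor_nonneg (m : ℕ) : 0 ≤ 2 / ((m : ℝ) * ((m : ℝ) - 1)) := by
  rcases Nat.eq_zero_or_pos m with rfl | hm
  · simp
  · have : (1 : ℝ) ≤ m := by exact_mod_cast hm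
    exact div_nonneg (by norm_num) (mul_nonneg (by linarith) (by linarith))

theorem coxeterLength_nonneg {m : ℕ} (p : Equiv.Perm (Fin m)) : 0 ≤ coxeterLength p :=
  mul_nonneg (coxeterFactor_nonneg m) (Nat.cast_nonneg _)

theorem coxeterLength_one {m : ℕ} : coxeterLength (1 : Equiv.Perm (Fin m)) = 0 := by
  have : inversions (1 : Equiv.Perm (Fin m)) = ∅ := by
    ext ⟨i, j⟩
    simp only [mem_inversions, Equiv.Perm.one_apply, Finset.notMem_empty, iff_false]
    exact fun h => lt_asymm h.1 h.2
  simp [coxeterLength, this]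

theorem coxeterLength_mul_le {m : ℕ} (p q : Equiv.Perm (Fin m)) :
    coxeterLength (p * q) ≤ coxeterLength p + coxeterLength q := by
  have h : inversions (p * q) ⊆
      (inversions p).map ((q⁻¹ : Equiv.Perm (Fin m)).prodCongr q⁻¹).toEmbedding ∪
        inversions q := by
    rintro ⟨i, j⟩ hij
    simp only [mem_inversions, Equiv.Perm.mul_apply, Finset.mem_union, Finset.mem_map,
      Prod.exists] at hij ⊢
    rcases lt_trichotomy (q i) (q j) with h | h | h
    · exact Or.inl ⟨q i, q j, ⟨h, hij.2⟩, by simp⟩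
    · exact absurd (q.injective h) hij.1.ne
    · exact Or.inr ⟨hij.1, h⟩
  have h' := (Finset.card_le_card h).trans (Finset.card_union_le _ _)
  rw [Finset.card_map] at h'
  unfold coxeterLength
  rw [← mul_add]
  refine mul_le_mul_of_nonneg_left ?_ (coxeterFactor_nonneg m)
  exact_mod_cast h'

theorem coxeterLength_inv_le {m : ℕ} (p : Equiv.Perm (Fin m)) :
    coxeterLength p⁻¹ ≤ coxeterLength p := by
  refine mul_le_mul_of_nonneg_left ?_ (coxeterFactor_nonneg m)
  have h : (inversions p⁻¹).card ≤ (inversions p).card := by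
    refine Finset.card_le_card_of_injOn (fun ij => (p⁻¹ ij.2, p⁻¹ ij.1)) ?_ ?_
    · rintro ⟨i, j⟩ hij
      simp only [SetLike.mem_coe, mem_inversions] at hij ⊢
      simpa using hij.symm
    · rintro ⟨i, j⟩ - ⟨i', j'⟩ - h
      simp only [Prod.mk.injEq, EmbeddingLike.apply_eq_iff_eq] at h
      rw [h.1, h.2]
  exact_mod_cast h

theorem coxeterLength_le {m : ℕ} (p : Equiv.Perm (Fin m)) :
    coxeterLength p ≤ 8 * hammingLength p := by
  rcases lt_or_ge m 2 with hm | hm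
  · have : coxeterLength p = 0 := by interval_cases m <;> simp [coxeterLength]
    rw [this]
    unfold hammingLength
    positivity
  have h : inversions p ⊆ p.support ×ˢ Finset.univ ∪ Finset.univ ×ˢ p.support := by
    rintro ⟨i, j⟩ hij
    simp only [mem_inversions, Finset.mem_univ, true_and, Finset.mem_union, Finset.mem_product,
       Equiv.Perm.mem_support, and_true] at hij ⊢
    by_contra! hc
    rw [hc.1, hc.2] at hij
    exact lt_asymm hij.1 hij.2
  have h' := (Finset.card_le_card h).trans (Finset.card_union_le _ _)
  simp only [Finset.card_product, Finset.card_univ, Fintype.card_fin] at h'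
  have h'' : ((inversions p).card : ℝ) ≤ p.support.card * m + m * p.support.card := by
    exact_mod_cast h'
  have hm' : (2 : ℝ) ≤ m := by exact_mod_cast hm
  have hs : (0 : ℝ) ≤ p.support.card := Nat.cast_nonneg _
  unfold coxeterLength hammingLength
  rw [div_mul_eq_mul_div, ← mul_div_assoc,
    div_le_div_iff₀ (mul_pos (by linarith) (by linarith)) (by linarith)]
  nlinarith [mul_nonneg (mul_nonneg hs (by linarith : (0 : ℝ) ≤ m))
    (by linarith : (0 : ℝ) ≤ m - 2), mul_le_mul_of_nonneg_right h'' (by linarith : (0 : ℝ) ≤ m)]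

theorem tendsto_coxeterLength (ω : Ultrafilter ℕ) (p : ∀ k, Equiv.Perm (Fin (n k))) :
    Tendsto (fun k => coxeterLength (p k)) ω (𝓝 (ulim ω fun k => coxeterLength (p k))) := by
  refine tendsto_ulim_real ω _ 8 fun k => ⟨coxeterLength_nonneg _, (coxeterLength_le _).trans ?_⟩
  have : hammingLength (p k) ≤ 1 := by
    refine div_le_one_of_le₀ ?_ (by positivity)
    have := (p k).support.card_le_univ
    rw [Fintype.card_fin] at this
    exact_mod_cast this
  linarith

theorem ulim_coxeterLength_le {p q : ∀ k, Equiv.Perm (Fin (n k))}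
    (h : p⁻¹ * q ∈ hammingNull ω n) :
    (ulim ω fun k => coxeterLength (q k)) ≤ ulim ω fun k => coxeterLength (p k) := by
  have h' : Tendsto (fun k => hammingLength ((p⁻¹ * q) k)) ω (𝓝 0) := h
  have h'' := (tendsto_coxeterLength ω p).add (h'.const_mul 8)
  rw [mul_zero, add_zero] at h''
  refine le_of_tendsto_of_tendsto' (tendsto_coxeterLength ω q) h'' fun k => ?_
  have := coxeterLength_mul_le (p k) ((p k)⁻¹ * q k)
  rw [mul_inv_cancel_left] at this
  exact this.trans (add_le_add le_rfl (coxeterLength_le _))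

/-- The Coxeter semi-length on the universal sofic group, `lim_{k → ω} ℓ_C(p_k)`. -/
def coxeterSemilength (p : UniversalSoficGroup ω n) : ℝ :=
  Quotient.liftOn' p (fun q => ulim ω fun k => coxeterLength (q k)) fun q r h => by
    rw [QuotientGroup.leftRel_apply] at h
    refine le_antisymm (ulim_coxeterLength_le ?_) (ulim_coxeterLength_le h)
    have := (hammingNull ω n).inv_mem h
    rwa [mul_inv_rev, inv_inv] at this

/-- The group `ℓ_0` of elements of Coxeter semi-length zero. -/
def ellZero (ω : Ultrafilter ℕ) (n : ℕ → ℕ) : Subgroup (UniversalSoficGroup ω n) where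
  carrier := {p | coxeterSemilength p = 0}
  one_mem' := ulim_eq (by simp [coxeterLength_one])
  mul_mem' := by
    intro p q
    induction p using QuotientGroup.induction_on with | H p =>
    induction q using QuotientGroup.induction_on with | H q =>
    intro hp hq
    have hp' := tendsto_coxeterLength ω p
    have hq' := tendsto_coxeterLength ω q
    rw [show (ulim ω fun k => coxeterLength (p k)) = 0 from hp] at hp'
    rw [show (ulim ω fun k => coxeterLength (q k)) = 0 from hq] at hq'
    have h := hp'.add hq'
    rw [add_zero] at h
    exact ulim_eq (squeeze_zero (fun k => coxeterLength_nonneg _)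
      (fun k => coxeterLength_mul_le (p k) (q k)) h)
  inv_mem' := by
    intro p
    induction p using QuotientGroup.induction_on with | H p =>
    intro hp
    have hp' := tendsto_coxeterLength ω p
    rw [show (ulim ω fun k => coxeterLength (p k)) = 0 from hp] at hp'
    exact ulim_eq (squeeze_zero (fun k => coxeterLength_nonneg _)
      (fun k => coxeterLength_inv_le (p k)) hp')

end Sofic

end

/-! Counting in the finite sets becomes measure theory in the limit. By countable saturation
(`exists_eventually_subset_of_internalSet_subset`) the Loeb measure of an internal set is its
limiting density. Counting grid points then shows that `St` carries the Loeb measure to Lebesgue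
measure (`measurePreserving_St`), so a restriction is unique up to null sets and restriction is a
well-defined homomorphism.

Kernel: the Coxeter length is small exactly when most points move little. Total displacement is at
most twice the number of inversions, which gives one direction by Markov's inequality. Conversely,
an inversion either involves a point moved by more than `ε` or is a pair at distance at most `2ε`,
and such pairs are few. Hence semi-length zero means `St (p x) = St x` almost everywhere
(`ulim_coxeterLength_eq_zero_iff`).

Surjectivity: for measure-preserving `φ`, approximation by continuous functions and a diagonal
argument produce an internal function `a` whose standard part is almost everywhere `φ ∘ St`
(`exists_internal_lifting_comp_St`). Let `p_k` send each index to the rank of its value under `a k`.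
The values are asymptotically uniform in the unit interval, so normalised rank and value agree in
the limit (`St_act_rankPerm`), and `p` restricts to `φ`. -/

namespace Sofic

variable {ω : Ultrafilter ℕ} {n : ℕ → ℕ}

/-! ### Countable saturation and the Loeb measure of internal sets -/

/-- A sequence of properties, each of which holds eventually, holds eventually along a slowly
growing index. -/
theorem exists_diagonal (hω : (ω : Filter ℕ) ≤ cofinite) {Q : ℕ → ℕ → Prop}
    (hQ : ∀ m, ∀ᶠ k in (ω : Filter ℕ), Q m k) :
    ∃ M : ℕ → ℕ, (∀ l, ∀ᶠ k in (ω : Filter ℕ), l ≤ M k) ∧ ∀ᶠ k in (ω : Filter ℕ), Q (M k) k := by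
  classical
  -- The cap `k` exceeds every `l` along `ω`, because `ω` is non-principal. `Q 0 k` ensures that the
  -- default value `0` of `findGreatest` also satisfies `Q`.
  refine ⟨fun k => Nat.findGreatest (fun m => Q m k) k, fun l => ?_, ?_⟩
  · have h : ∀ᶠ k in (ω : Filter ℕ), l ≤ k := by
      rw [Nat.cofinite_eq_atTop] at hω
      exact hω (eventually_ge_atTop l)
    filter_upwards [h, hQ l] with k h1 h2
    exact Nat.le_findGreatest h1 h2
  · filter_upwards [hQ 0] with k h
    exact Nat.findGreatest_spec (P := fun m => Q m k) (Nat.zero_le k) h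

/-- The point of the Loeb space represented by a sequence. -/
def loebPoint (ω : Ultrafilter ℕ) (x : ∀ k, Fin (n k)) : LoebSpace ω n :=
  Quotient.mk _ x

theorem exists_loebPoint (x : LoebSpace ω n) : ∃ a, loebPoint ω a = x :=
  Quotient.exists_rep x

theorem loebPoint_mem {x : ∀ k, Fin (n k)} {A : ∀ k, Finset (Fin (n k))} :
    loebPoint ω x ∈ internalSet ω A ↔ ∀ᶠ k in (ω : Filter ℕ), x k ∈ A k :=
  Iff.rfl

/-- Saturation: otherwise, choosing `x k` in `A k` outside `B l k` for all `l ≤ M k`, with `M` a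
diagonal index, yields a point of the left side that lies in no `internalSet ω (B l)`. -/
theorem exists_eventually_subset_of_internalSet_subset (hω : (ω : Filter ℕ) ≤ cofinite)
    (hpos : ∀ k, 0 < n k) {A : ∀ k, Finset (Fin (n k))} {B : ℕ → ∀ k, Finset (Fin (n k))}
    (h : internalSet ω A ⊆ ⋃ m, internalSet ω (B m)) :
    ∃ m, ∀ᶠ k in (ω : Filter ℕ), A k ⊆ (Finset.range (m + 1)).biUnion fun l => B l k := by
  by_contra! hc
  obtain ⟨M, hM, hM'⟩ := exists_diagonal hω
    (Q := fun m k => ¬ A k ⊆ (Finset.range (m + 1)).biUnion fun l => B l k)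
    hc
  have hx : ∀ k, ∃ x : Fin (n k), (¬ A k ⊆ (Finset.range (M k + 1)).biUnion fun l => B l k) →
      x ∈ A k ∧ ∀ l ≤ M k, x ∉ B l k := by
    intro k
    by_cases hk : A k ⊆ (Finset.range (M k + 1)).biUnion fun l => B l k
    · exact ⟨⟨0, hpos k⟩, fun h' => absurd hk h'⟩
    · obtain ⟨x, hx, hx'⟩ := Finset.not_subset.1 hk
      refine ⟨x, fun _ => ⟨hx, fun l hl hl' => hx' ?_⟩⟩
      exact Finset.mem_biUnion.2 ⟨l, Finset.mem_range.2 (Nat.lt_succ_of_le hl), hl'⟩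
  choose x hx using hx
  have hxA : loebPoint ω x ∈ internalSet ω A := hM'.mono fun k hk => (hx k hk).1
  obtain ⟨l, hl⟩ := Set.mem_iUnion.1 (h hxA)
  obtain ⟨k, h1, h2, h3⟩ := ((hM l).and (hM'.and (loebPoint_mem.1 hl))).exists
  exact (hx k h2).2 l h1 h3

theorem internalSize_le_of_eventually {A : ∀ k, Finset (Fin (n k))} {c : ℝ≥0∞}
    (h : ∀ᶠ k in (ω : Filter ℕ), ((A k).card : ℝ≥0∞) / n k ≤ c) : internalSize ω A ≤ c :=
  le_of_tendsto (internalSize_tendsto A) h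

theorem internalSize_le_sum {A : ∀ k, Finset (Fin (n k))} {B : ℕ → ∀ k, Finset (Fin (n k))}
    {s : Finset ℕ} (h : ∀ᶠ k in (ω : Filter ℕ), A k ⊆ s.biUnion fun l => B l k) :
    internalSize ω A ≤ ∑ l ∈ s, internalSize ω (B l) := by
  refine le_of_tendsto_of_tendsto (internalSize_tendsto A)
    (tendsto_finsetSum s fun l _ => internalSize_tendsto (B l)) (h.mono fun k hk => ?_)
  simp only [div_eq_mul_inv, ← Finset.sum_mul]
  gcongr
  exact_mod_cast (Finset.card_le_card hk).trans Finset.card_biUnion_le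

/-- `loebPre` is an infimum over all sequences representing a set, so sizes must be controlled by
the sets alone. If `A k ⊆ B k` failed along `ω`, the witnesses would form a point violating the
inclusion. -/
theorem internalSize_mono (hpos : ∀ k, 0 < n k) {A B : ∀ k, Finset (Fin (n k))}
    (h : internalSet ω A ⊆ internalSet ω B) : internalSize ω A ≤ internalSize ω B := by
  have hAB : ∀ᶠ k in (ω : Filter ℕ), A k ⊆ B k := by
    by_contra hc
    rw [← Ultrafilter.eventually_not] at hc
    have hx : ∀ k, ∃ x : Fin (n k), ¬ A k ⊆ B k → x ∈ A k ∧ x ∉ B k := by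
      intro k
      by_cases hk : A k ⊆ B k
      · exact ⟨⟨0, hpos k⟩, fun h' => absurd hk h'⟩
      · obtain ⟨x, hx⟩ := Finset.not_subset.1 hk
        exact ⟨x, fun _ => hx⟩
    choose x hx using hx
    have hxA : loebPoint ω x ∈ internalSet ω A := hc.mono fun k hk => (hx k hk).1
    obtain ⟨k, h1, h2⟩ := (hc.and (loebPoint_mem.1 (h hxA))).exists
    exact (hx k h1).2 h2
  refine le_of_tendsto_of_tendsto (internalSize_tendsto A) (internalSize_tendsto B)
    (hAB.mono fun k hk => ENNReal.div_le_div_right ?_ _)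
  exact_mod_cast Finset.card_le_card hk

/-- Saturation reduces a countable internal cover to a finite one, where cardinality is subadditive.
-/
theorem loebMeasure_internalSet (hω : (ω : Filter ℕ) ≤ cofinite) (hpos : ∀ k, 0 < n k)
    (A : ∀ k, Finset (Fin (n k))) : loebMeasure ω n (internalSet ω A) = internalSize ω A := by
  refine le_antisymm (loebMeasure_internalSet_le A) ?_
  rw [loebMeasure, toMeasure_apply _ _ (measurableSet_internalSet A), loebOuter,
    OuterMeasure.ofFunction_apply]
  refine le_iInf₂ fun t ht => ?_
  by_cases hB : ∀ m, ∃ B, internalSet ω B = t m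
  · choose B hB using hB
    obtain rfl : (fun m => internalSet ω (B m)) = t := funext hB
    obtain ⟨m, hm⟩ := exists_eventually_subset_of_internalSet_subset hω hpos ht
    refine (internalSize_le_sum hm).trans (le_trans ?_ (ENNReal.sum_le_tsum (Finset.range (m + 1))))
    exact Finset.sum_le_sum fun l _ => le_iInf₂ fun C hC => internalSize_mono hpos hC.ge
  · push Not at hB
    obtain ⟨m, hm⟩ := hB
    -- A non-internal set has no representation, so its infimum is over the empty family.
    have : loebPre ω n (t m) = ∞ := by simp [loebPre, hm]
    exact le_top.trans (this.ge.trans (ENNReal.le_tsum m))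

theorem internalSize_univ (hpos : ∀ k, 0 < n k) :
    internalSize ω (fun k => (Finset.univ : Finset (Fin (n k)))) = 1 := by
  refine ulim_eq (tendsto_const_nhds.congr fun k => ?_)
  have := hpos k
  rw [Finset.card_univ, Fintype.card_fin, ENNReal.div_self] <;> simp [this.ne']

theorem internalSet_univ : internalSet ω (fun k => (Finset.univ : Finset (Fin (n k)))) =
    Set.univ := by
  refine Set.eq_univ_of_forall fun x => ?_
  obtain ⟨x, rfl⟩ := exists_loebPoint x
  simp [loebPoint_mem]

theorem isProbabilityMeasure_loebMeasure (hω : (ω : Filter ℕ) ≤ cofinite) (hpos : ∀ k, 0 < n k) :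
    IsProbabilityMeasure (loebMeasure ω n) :=
  ⟨by rw [← internalSet_univ, loebMeasure_internalSet hω hpos, internalSize_univ hpos]⟩

/-! ### Standard parts of internal functions -/

/-- The standard part `(x_k)_k ↦ lim_{k → ω} a_k(x_k)` of an internal function. -/
noncomputable def stdPart (ω : Ultrafilter ℕ) (a : ∀ k, Fin (n k) → I) (x : LoebSpace ω n) : I :=
  Quotient.liftOn x (fun x => ulim ω fun k => a k (x k)) fun b c h => by
    refine congrArg lim (Filter.map_congr ?_)
    exact Eventually.mono h fun k hk => by simp only [hk]

theorem tendsto_stdPart (a : ∀ k, Fin (n k) → I) (x : ∀ k, Fin (n k)) :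
    Tendsto (fun k => a k (x k)) ω (𝓝 (stdPart ω a (loebPoint ω x))) :=
  tendsto_ulim ω fun k => a k (x k)

/-- Strict inequalities pass from a limit to the terms, weak ones from the terms to the limit. So
the internal sets `a < t` and `a ≤ t` lie between the open and the closed sublevel set of the
standard part. -/
theorem stdPart_lt_subset (a : ∀ k, Fin (n k) → I) (t : I) :
    {x | stdPart ω a x < t} ⊆ internalSet ω fun k => Finset.univ.filter fun i => a k i < t := by
  intro x hx
  obtain ⟨x, rfl⟩ := exists_loebPoint x
  rw [loebPoint_mem]
  filter_upwards [(tendsto_stdPart a x).eventually_lt_const hx] with k hk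
  simpa using hk

theorem internalSet_le_subset (a : ∀ k, Fin (n k) → I) (t : I) :
    (internalSet ω fun k => Finset.univ.filter fun i => a k i ≤ t) ⊆ {x | stdPart ω a x ≤ t} := by
  intro x hx
  obtain ⟨x, rfl⟩ := exists_loebPoint x
  rw [loebPoint_mem] at hx
  exact le_of_tendsto (tendsto_stdPart a x) (hx.mono fun k hk => by simpa using hk)

theorem internalSet_lt_subset_internalSet_le (a : ∀ k, Fin (n k) → I) (t : I) :
    (internalSet ω fun k => Finset.univ.filter fun i => a k i < t) ⊆
      internalSet ω fun k => Finset.univ.filter fun i => a k i ≤ t := by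
  intro x hx
  obtain ⟨x, rfl⟩ := exists_loebPoint x
  rw [loebPoint_mem] at hx ⊢
  refine hx.mono fun k hk => ?_
  simp only [Finset.mem_filter_univ] at hk ⊢
  exact hk.le

theorem measurable_stdPart (a : ∀ k, Fin (n k) → I) : Measurable (stdPart ω a) := by
  refine measurable_of_Iio fun t => ?_
  obtain ⟨S, hS, hS'⟩ := TopologicalSpace.exists_countable_dense I
  have h : stdPart ω a ⁻¹' Set.Iio t = ⋃ s ∈ {s ∈ S | s < t},
      internalSet ω fun k => Finset.univ.filter fun i => a k i < s := by
    ext x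
    simp only [Set.mem_preimage, Set.mem_Iio, Set.mem_iUnion, exists_prop]
    constructor
    · intro hx
      obtain ⟨s, hs, h1, h2⟩ := hS'.exists_between hx
      exact ⟨s, ⟨hs, h2⟩, stdPart_lt_subset a s h1⟩
    · rintro ⟨s, ⟨-, hs⟩, hx⟩
      exact (internalSet_le_subset a s (internalSet_lt_subset_internalSet_le a s hx)).trans_lt hs
  rw [h]
  exact MeasurableSet.biUnion (hS.mono fun s hs => hs.1) fun s _ => measurableSet_internalSet _

/-- The points `1 / m, 2 / m, …, 1`. -/
noncomputable def gridPoint {m : ℕ} (i : Fin m) : I :=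
  ⟨((i : ℕ) + 1 : ℝ) / (m : ℝ), by
    have h : ((i : ℕ) + 1 : ℝ) ≤ (m : ℝ) := by exact_mod_cast i.isLt
    exact ⟨by positivity, div_le_one_of_le₀ h (by positivity)⟩⟩

theorem tendsto_St (x : ∀ k, Fin (n k)) :
    Tendsto (fun k => gridPoint (x k)) ω (𝓝 (St ω n (loebPoint ω x))) :=
  tendsto_stdPart (fun _ => gridPoint) x

theorem stdPart_comp_gridPoint {g : I → I} (hg : Continuous g) (x : LoebSpace ω n) :
    stdPart ω (fun _ i => g (gridPoint i)) x = g (St ω n x) := by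
  obtain ⟨x, rfl⟩ := exists_loebPoint x
  exact ulim_eq ((hg.tendsto _).comp (tendsto_St x))

theorem measurable_St : Measurable (St ω n) :=
  measurable_stdPart fun _ => gridPoint

theorem card_gridPoint_le {m : ℕ} (hm : 0 < m) (t : I) :
    (Finset.univ.filter fun i : Fin m => gridPoint i ≤ t).card = ⌊(t : ℝ) * m⌋₊ := by
  have hm' : (0 : ℝ) < m := by exact_mod_cast hm
  have h : ⌊(t : ℝ) * m⌋₊ ≤ m := by
    refine Nat.floor_le_of_le ?_
    nlinarith [t.2.2]
  rw [← Fintype.card_fin ⌊(t : ℝ) * m⌋₊, ← Finset.card_univ,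
    ← Finset.card_map (Fin.castLEEmb h)]
  congr 1
  ext i
  simp only [Finset.mem_filter_univ, Finset.mem_map, Finset.mem_univ, true_and]
  have h1 : gridPoint i ≤ t ↔ (i : ℕ) < ⌊(t : ℝ) * m⌋₊ := by
    rw [← Subtype.coe_le_coe, gridPoint, div_le_iff₀ hm', Nat.lt_iff_add_one_le,
      Nat.le_floor_iff (mul_nonneg t.2.1 hm'.le)]
    push_cast
    rfl
  rw [h1]
  constructor
  · exact fun hi => ⟨⟨i, hi⟩, rfl⟩
  · rintro ⟨j, rfl⟩
    exact j.2

theorem internalSize_gridPoint_le (hω : (ω : Filter ℕ) ≤ cofinite) (hpos : ∀ k, 0 < n k)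
    (hn : Tendsto n atTop atTop) (t : I) :
    internalSize ω (fun k => Finset.univ.filter fun i : Fin (n k) => gridPoint i ≤ t) =
      ENNReal.ofReal t := by
  refine ulim_eq ?_
  rw [Nat.cofinite_eq_atTop] at hω
  have h := ENNReal.tendsto_ofReal (((tendsto_nat_floor_mul_div_atTop t.2.1).comp
    (tendsto_natCast_atTop_atTop.comp hn)).mono_left hω)
  refine h.congr fun k => ?_
  rw [card_gridPoint_le (hpos k)]
  simp only [Function.comp_apply]
  rw [ENNReal.ofReal_div_of_pos (by exact_mod_cast hpos k)]
  simp

theorem measurePreserving_St (hω : (ω : Filter ℕ) ≤ cofinite) (hpos : ∀ k, 0 < n k)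
    (hn : Tendsto n atTop atTop) : MeasurePreserving (St ω n) (loebMeasure ω n) volume := by
  have := isProbabilityMeasure_loebMeasure hω hpos
  refine ⟨measurable_St, ?_⟩
  refine (Measure.ext_of_Iic _ _ fun t => ?_).symm
  rw [Measure.map_apply measurable_St measurableSet_Iic, unitInterval.volume_Iic]
  refine le_antisymm ?_ ?_
  · rw [← internalSize_gridPoint_le hω hpos hn t, ← loebMeasure_internalSet hω hpos]
    exact measure_mono (internalSet_le_subset _ t)
  -- `St x ≤ t` places `x` in the internal set of level `s` only for `s > t`; then `s` decreases to
  -- `t`. No such `s` exists when `t = 1`.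
  · rcases eq_or_lt_of_le (show t ≤ 1 from t.2.2) with rfl | ht
    · simpa using prob_le_one
    have hlim : Tendsto (fun s : I => ENNReal.ofReal s) (𝓝[>] t) (𝓝 (ENNReal.ofReal t)) :=
      (ENNReal.continuous_ofReal.comp continuous_subtype_val).continuousWithinAt
    have : (𝓝[>] t).NeBot := nhdsGT_neBot_of_exists_gt ⟨1, ht⟩
    refine ge_of_tendsto hlim (eventually_mem_nhdsWithin.mono fun s hs => ?_)
    rw [← internalSize_gridPoint_le hω hpos hn s, ← loebMeasure_internalSet hω hpos]
    refine measure_mono fun x hx => internalSet_lt_subset_internalSet_le _ _ ?_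
    exact stdPart_lt_subset _ s (lt_of_le_of_lt (show St ω n x ≤ t from hx) hs)

/-! ### The Coxeter length and displacements -/

theorem dist_gridPoint {m : ℕ} (i j : Fin m) :
    dist (gridPoint i) (gridPoint j) = |((i : ℕ) : ℝ) - ((j : ℕ) : ℝ)| / m := by
  rw [Subtype.dist_eq, Real.dist_eq, gridPoint, gridPoint, ← sub_div, abs_div, Nat.abs_cast]
  simp

theorem card_filter_perm_lt {m : ℕ} (p : Equiv.Perm (Fin m)) (i : Fin m) :
    (Finset.univ.filter fun j => p j < i).card = i := by
  rw [← Fin.card_Iio i, ← Finset.card_map (s := Finset.Iio i) p.symm.toEmbedding]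
  congr 1
  ext j
  simp

/-- `p i` counts the `j` with `p j < p i`, and each such `j` is below `i` or gives an inversion `(i,
j)`. -/
theorem apply_le_add_card_inversions {m : ℕ} (p : Equiv.Perm (Fin m)) (i : Fin m) :
    (p i : ℕ) ≤ i + ((inversions p).filter fun x => x.1 = i).card := by
  have h : (Finset.univ.filter fun j => p j < p i) ⊆
      Finset.Iio i ∪ ((inversions p).filter fun x => x.1 = i).image Prod.snd := by
    intro j hj
    rw [Finset.mem_filter_univ] at hj
    rcases lt_trichotomy j i with h | rfl | h
    · simp [h]
    · exact absurd hj (lt_irrefl _)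
    · refine Finset.mem_union_right _ (Finset.mem_image.2 ⟨(i, j), ?_, rfl⟩)
      exact Finset.mem_filter.2 ⟨(mem_inversions p i j).2 ⟨h, hj⟩, rfl⟩
  have h' := (Finset.card_le_card h).trans (Finset.card_union_le _ _)
  rw [card_filter_perm_lt, Fin.card_Iio] at h'
  exact h'.trans (Nat.add_le_add_left Finset.card_image_le _)

theorem le_apply_add_card_inversions {m : ℕ} (p : Equiv.Perm (Fin m)) (i : Fin m) :
    (i : ℕ) ≤ p i + ((inversions p).filter fun x => x.2 = i).card := by
  have h : Finset.Iio i ⊆ (Finset.univ.filter fun j => p j < p i) ∪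
      ((inversions p).filter fun x => x.2 = i).image Prod.fst := by
    intro j hj
    rw [Finset.mem_Iio] at hj
    rcases lt_trichotomy (p j) (p i) with h | h | h
    · simp [h]
    · exact absurd (p.injective h) hj.ne
    · refine Finset.mem_union_right _ (Finset.mem_image.2 ⟨(j, i), ?_, rfl⟩)
      exact Finset.mem_filter.2 ⟨(mem_inversions p j i).2 ⟨hj, h⟩, rfl⟩
  have h' := (Finset.card_le_card h).trans (Finset.card_union_le _ _)
  rw [card_filter_perm_lt, Fin.card_Iio] at h'
  exact h'.trans (Nat.add_le_add_left Finset.card_image_le _)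

/-- The total displacement of a permutation is at most twice its number of inversions. -/
theorem sum_abs_apply_sub_le {m : ℕ} (p : Equiv.Perm (Fin m)) :
    ∑ i, |((p i : ℕ) : ℝ) - ((i : ℕ) : ℝ)| ≤ 2 * (inversions p).card := by
  have h1 := Finset.card_eq_sum_card_fiberwise (f := Prod.fst) (s := inversions p)
    (t := Finset.univ) fun _ _ => Finset.mem_univ _
  have h2 := Finset.card_eq_sum_card_fiberwise (f := Prod.snd) (s := inversions p)
    (t := Finset.univ) fun _ _ => Finset.mem_univ _
  have h3 : (2 * (inversions p).card : ℝ) =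
      ∑ i, ((((inversions p).filter fun x => x.1 = i).card : ℝ) +
        ((inversions p).filter fun x => x.2 = i).card) := by
    rw [Finset.sum_add_distrib, two_mul]
    exact_mod_cast congrArg₂ (· + ·) h1 h2
  rw [h3]
  refine Finset.sum_le_sum fun i _ => ?_
  have h4 : ((p i : ℕ) : ℝ) ≤ (i : ℕ) + ((inversions p).filter fun x => x.1 = i).card := by
    exact_mod_cast apply_le_add_card_inversions p i
  have h5 : ((i : ℕ) : ℝ) ≤ (p i : ℕ) + ((inversions p).filter fun x => x.2 = i).card := by
    exact_mod_cast le_apply_add_card_inversions p i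
  rw [abs_le]
  constructor <;> linarith [Nat.cast_nonneg (α := ℝ) ((inversions p).filter fun x => x.1 = i).card,
    Nat.cast_nonneg (α := ℝ) ((inversions p).filter fun x => x.2 = i).card]

/-- The points that a permutation moves by more than `ε`, in normalised distance. -/
noncomputable def displaced {m : ℕ} (p : Equiv.Perm (Fin m)) (ε : ℝ) : Finset (Fin m) :=
  Finset.univ.filter fun i => ε < dist (gridPoint (p i)) (gridPoint i)

theorem mem_displaced {m : ℕ} {p : Equiv.Perm (Fin m)} {ε : ℝ} {i : Fin m} :
    i ∈ displaced p ε ↔ ε < dist (gridPoint (p i)) (gridPoint i) :=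
  Finset.mem_filter_univ _

/-- Markov's inequality for the total displacement, together with `2 / m² ≤ 2 / (m (m - 1))`. For `m
< 2` nothing moves. -/
theorem mul_card_displaced_le {m : ℕ} (p : Equiv.Perm (Fin m)) (ε : ℝ) :
    ε * ((displaced p ε).card / m) ≤ coxeterLength p := by
  rcases lt_or_ge m 2 with hm | hm
  · have : Subsingleton (Fin m) := Fin.subsingleton_iff_le_one.2 (by omega)
    rcases le_or_gt ε 0 with hε | hε
    · exact (mul_nonpos_of_nonpos_of_nonneg hε (by positivity)).trans (coxeterLength_nonneg p)
    · have h : displaced p ε = ∅ := by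
        refine Finset.eq_empty_of_forall_notMem fun i hi => ?_
        rw [mem_displaced, Subsingleton.elim (p i) i, dist_self] at hi
        exact lt_asymm hε hi
      simpa [h] using coxeterLength_nonneg p
  · have hm' : (2 : ℝ) ≤ m := by exact_mod_cast hm
    have h1 : (displaced p ε).card * ε ≤ ∑ i, dist (gridPoint (p i)) (gridPoint i) := by
      rw [← nsmul_eq_mul]
      refine (Finset.card_nsmul_le_sum _ (fun i => dist (gridPoint (p i)) (gridPoint i)) _
        fun i hi => (mem_displaced.1 hi).le).trans ?_
      exact Finset.sum_le_sum_of_subset_of_nonneg (Finset.subset_univ _) fun _ _ _ => dist_nonneg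
    simp only [dist_gridPoint, ← Finset.sum_div] at h1
    have h2 := h1.trans (div_le_div_of_nonneg_right (sum_abs_apply_sub_le p)
      (by linarith : (0 : ℝ) ≤ m))
    have hI : (0 : ℝ) ≤ (inversions p).card := Nat.cast_nonneg _
    calc ε * ((displaced p ε).card / m) = (displaced p ε).card * ε / m := by ring
      _ ≤ 2 * (inversions p).card / m / m := by gcongr
      _ = 2 / (m * m) * (inversions p).card := by field_simp
      _ ≤ coxeterLength p := by
        unfold coxeterLength
        gcongr
        · exact mul_pos (by linarith) (by linarith)
        · linarith

/-- If both points move by at most `ε`, their order can be reversed only when they start within `2ε`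
of each other. -/
theorem inversions_subset_union {m : ℕ} (p : Equiv.Perm (Fin m)) (ε : ℝ) :
    inversions p ⊆ displaced p ε ×ˢ Finset.univ ∪ Finset.univ ×ˢ displaced p ε ∪
      Finset.univ.filter fun x => x.1 < x.2 ∧ dist (gridPoint x.2) (gridPoint x.1) ≤ 2 * ε := by
  rintro ⟨i, j⟩ hij
  obtain ⟨h1, h2⟩ := (mem_inversions p i j).1 hij
  simp only [Finset.mem_union, Finset.mem_product, Finset.mem_univ, and_true, true_and,
    Finset.mem_filter_univ, mem_displaced]
  by_contra! hc
  obtain ⟨⟨hi, hj⟩, hc⟩ := hc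
  have h3 := hc h1
  have hm : (0 : ℝ) < m := by exact_mod_cast i.pos
  have h1' : ((i : ℕ) : ℝ) < (j : ℕ) := by exact_mod_cast h1
  have h2' : ((p j : ℕ) : ℝ) < (p i : ℕ) := by exact_mod_cast h2
  rw [dist_gridPoint] at hi hj h3
  rw [div_le_iff₀ hm] at hi hj
  rw [lt_div_iff₀ hm, abs_of_pos (by linarith)] at h3
  linarith [le_abs_self (((p i : ℕ) : ℝ) - (i : ℕ)), neg_le_abs (((p j : ℕ) : ℝ) - (j : ℕ))]

theorem card_close_pairs_le {m : ℕ} {δ : ℝ} (hδ : 0 ≤ δ) :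
    ((Finset.univ.filter fun x : Fin m × Fin m =>
      x.1 < x.2 ∧ dist (gridPoint x.2) (gridPoint x.1) ≤ δ).card : ℝ) ≤ m * (δ * m) := by
  have h : (Finset.univ.filter fun x : Fin m × Fin m =>
      x.1 < x.2 ∧ dist (gridPoint x.2) (gridPoint x.1) ≤ δ).card ≤
      ((Finset.univ : Finset (Fin m)) ×ˢ Finset.range ⌊δ * m⌋₊).card := by
    -- For fixed first entry the gap lies between `1` and `⌊δ * m⌋₊`; subtracting `1` moves it into
    -- the range.
    refine Finset.card_le_card_of_injOn (fun x => (x.1, (x.2 : ℕ) - x.1 - 1)) ?_ ?_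
    · rintro ⟨i, j⟩ hij
      simp only [Finset.coe_filter, Finset.mem_univ, true_and, Set.mem_ofPred_eq] at hij
      obtain ⟨h1, h2⟩ := hij
      have hm : (0 : ℝ) < m := by exact_mod_cast i.pos
      have h1' : ((i : ℕ) : ℝ) < (j : ℕ) := by exact_mod_cast h1
      rw [dist_gridPoint, div_le_iff₀ hm, abs_of_pos (by linarith)] at h2
      have h1'' : (i : ℕ) < j := h1
      have h3 : (j : ℕ) - i ≤ ⌊δ * m⌋₊ := by
        rw [Nat.le_floor_iff (by positivity), Nat.cast_sub h1''.le]
        exact h2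
      simp only [Finset.coe_product, Set.mem_prod, Finset.mem_coe, Finset.mem_univ,
        Finset.mem_range, true_and]
      omega
    · rintro ⟨i, j⟩ hij ⟨i', j'⟩ hij' h
      simp only [Finset.coe_filter, Finset.mem_univ, true_and, Set.mem_ofPred_eq] at hij hij'
      simp only [Prod.mk.injEq] at h ⊢
      obtain ⟨rfl, h⟩ := h
      have h1 : (i : ℕ) < j := hij.1
      have h2 : (i : ℕ) < j' := hij'.1
      exact ⟨rfl, Fin.ext (by omega)⟩
  rw [Finset.card_product, Finset.card_univ, Fintype.card_fin, Finset.card_range] at h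
  refine (Nat.cast_le.2 h).trans ?_
  push_cast
  gcongr
  exact Nat.floor_le (by positivity)

theorem coxeterLength_le_displaced {m : ℕ} (p : Equiv.Perm (Fin m)) {ε : ℝ} (hε : 0 ≤ ε) :
    coxeterLength p ≤ 8 * ((displaced p ε).card / m + ε) := by
  rcases lt_or_ge m 2 with hm | hm
  · have : coxeterLength p = 0 := by interval_cases m <;> simp [coxeterLength]
    rw [this]
    positivity
  have h := (Finset.card_le_card (inversions_subset_union p ε)).trans
    ((Finset.card_union_le _ _).trans (Nat.add_le_add_right (Finset.card_union_le _ _) _))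
  simp only [Finset.card_product, Finset.card_univ, Fintype.card_fin] at h
  have h1 : ((inversions p).card : ℝ) ≤ (displaced p ε).card * m + m * (displaced p ε).card +
      m * (2 * ε * m) :=
    (Nat.cast_le.2 h).trans (by
      push_cast
      gcongr
      exact card_close_pairs_le (by positivity))
  have hm' : (2 : ℝ) ≤ m := by exact_mod_cast hm
  -- For `m ≥ 2`, replacing `m (m - 1)` by `m²` costs a factor `2`; this is where the constant `8`
  -- comes from.
  have h2 : 2 / ((m : ℝ) * (m - 1)) ≤ 4 / (m * m) := by
    rw [div_le_div_iff₀ (mul_pos (by linarith) (by linarith)) (by positivity)]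
    nlinarith
  calc coxeterLength p ≤ 4 / (m * m) * ((displaced p ε).card * m + m * (displaced p ε).card +
        m * (2 * ε * m)) := by
        unfold coxeterLength
        gcongr
    _ = 8 * ((displaced p ε).card / m + ε) := by
        field_simp
        ring

theorem internalSize_eq_zero_iff (hpos : ∀ k, 0 < n k) (A : ∀ k, Finset (Fin (n k))) :
    internalSize ω A = 0 ↔ Tendsto (fun k => ((A k).card : ℝ) / n k) ω (𝓝 0) := by
  have h : ∀ k, ENNReal.ofReal ((A k).card / n k) = ((A k).card : ℝ≥0∞) / n k := fun k => by
    rw [ENNReal.ofReal_div_of_pos (by exact_mod_cast hpos k)]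
    simp
  constructor
  · intro h0
    have h1 := (ENNReal.tendsto_toReal ENNReal.zero_ne_top).comp (h0 ▸ internalSize_tendsto A)
    refine h1.congr fun k => ?_
    simp
  · intro h1
    have h2 := ENNReal.tendsto_ofReal h1
    rw [ENNReal.ofReal_zero] at h2
    exact ulim_eq (h2.congr h)

theorem tendsto_dist_St_act (p : ∀ k, Equiv.Perm (Fin (n k))) (x : ∀ k, Fin (n k)) :
    Tendsto (fun k => dist (gridPoint (p k (x k))) (gridPoint (x k))) ω
      (𝓝 (dist (St ω n (act ω p (loebPoint ω x))) (St ω n (loebPoint ω x)))) :=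
  (tendsto_St fun k => p k (x k)).dist (tendsto_St x)

theorem ulim_coxeterLength_eq_zero_iff (hω : (ω : Filter ℕ) ≤ cofinite) (hpos : ∀ k, 0 < n k)
    (p : ∀ k, Equiv.Perm (Fin (n k))) :
    (ulim ω fun k => coxeterLength (p k)) = 0 ↔
      ∀ᵐ x ∂loebMeasure ω n, St ω n (act ω p x) = St ω n x := by
  constructor
  · intro h
    have hp := tendsto_coxeterLength ω p
    rw [h] at hp
    have h1 : ∀ m : ℕ, ∀ᵐ x ∂loebMeasure ω n,
        x ∉ internalSet ω fun k => displaced (p k) (1 / (m + 1)) := by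
      intro m
      rw [← measure_eq_zero_iff_ae_notMem]
      refine le_antisymm ((loebMeasure_internalSet_le _).trans_eq ?_) bot_le
      rw [internalSize_eq_zero_iff hpos]
      have h2 := hp.const_mul ((m : ℝ) + 1)
      rw [mul_zero] at h2
      refine squeeze_zero (fun k => by positivity) (fun k => ?_) h2
      have h3 := mul_card_displaced_le (p k) (1 / ((m : ℝ) + 1))
      rwa [div_mul_eq_mul_div, one_mul, div_le_iff₀' (by positivity)] at h3
    filter_upwards [ae_all_iff.2 h1] with x hx
    obtain ⟨x, rfl⟩ := exists_loebPoint x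
    rw [← dist_le_zero]
    refine ge_of_tendsto' tendsto_one_div_add_atTop_nhds_zero_nat fun m => ?_
    refine le_of_tendsto (tendsto_dist_St_act p x) ?_
    refine (Ultrafilter.eventually_not.2 (hx m)).mono fun k hk => ?_
    simpa [mem_displaced] using hk
  · intro h
    refine ulim_eq ?_
    rw [Metric.tendsto_nhds]
    intro ε hε
    -- With threshold `ε / 16` and density of displaced points below `ε / 16`, the bound is `8 * (ε
    -- / 16 + ε / 16) = ε`.
    have h0 : internalSize ω (fun k => displaced (p k) (ε / 16)) = 0 := by
      rw [← loebMeasure_internalSet hω hpos, measure_eq_zero_iff_ae_notMem]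
      filter_upwards [h] with x hx hx'
      obtain ⟨x, rfl⟩ := exists_loebPoint x
      have h1 := ge_of_tendsto (tendsto_dist_St_act p x)
        ((loebPoint_mem.1 hx').mono fun k hk => (mem_displaced.1 hk).le)
      rw [hx, dist_self] at h1
      linarith
    rw [internalSize_eq_zero_iff hpos] at h0
    filter_upwards [h0.eventually_lt_const (by positivity : 0 < ε / 16)] with k hk
    rw [Real.dist_0_eq_abs, abs_of_nonneg (coxeterLength_nonneg _)]
    linarith [coxeterLength_le_displaced (p k) (by positivity : 0 ≤ ε / 16)]

/-! ### Internal liftings -/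

theorem tendsto_dist_stdPart (a b : ∀ k, Fin (n k) → I) (x : ∀ k, Fin (n k)) :
    Tendsto (fun k => dist (a k (x k)) (b k (x k))) ω
      (𝓝 (dist (stdPart ω a (loebPoint ω x)) (stdPart ω b (loebPoint ω x)))) :=
  (tendsto_stdPart a x).dist (tendsto_stdPart b x)

/-- The places where two internal functions differ by more than `ε`. -/
noncomputable def farSet {m : ℕ} (a b : Fin m → I) (ε : ℝ) : Finset (Fin m) :=
  Finset.univ.filter fun i => ε < dist (a i) (b i)

theorem mem_farSet {m : ℕ} {a b : Fin m → I} {ε : ℝ} {i : Fin m} :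
    i ∈ farSet a b ε ↔ ε < dist (a i) (b i) :=
  Finset.mem_filter_univ _

/-- A limit in measure of standard parts of internal functions is almost everywhere the standard
part of an internal function. -/
theorem exists_internal_lifting (hω : (ω : Filter ℕ) ≤ cofinite) (hpos : ∀ k, 0 < n k)
    (F : LoebSpace ω n → I) (b : ℕ → ∀ k, Fin (n k) → I)
    (hb : ∀ m, loebMeasure ω n {x | (1 / 2 : ℝ) ^ m ≤ dist (stdPart ω (b m) x) (F x)} ≤
      (1 / 2 : ℝ≥0∞) ^ m) :
    ∃ a : ∀ k, Fin (n k) → I, ∀ᵐ x ∂loebMeasure ω n, stdPart ω a x = F x := by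
  have hpow : ∀ m : ℕ, (1 / 2 : ℝ≥0∞) ^ m ≠ 0 ∧ (1 / 2 : ℝ≥0∞) ^ m ≠ ∞ := fun m =>
    ⟨pow_ne_zero _ (by simp), ENNReal.pow_ne_top (by simp)⟩
  -- Closeness to `F` in measure makes the `b m` a Cauchy sequence in measure, a property visible in
  -- the finite counts without `F`.
  have hsize : ∀ m l, m ≤ l → internalSize ω
      (fun k => farSet (b m k) (b l k) (2 * (1 / 2 : ℝ) ^ m)) ≤ 2 * (1 / 2 : ℝ≥0∞) ^ m := by
    intro m l hml
    rw [← loebMeasure_internalSet hω hpos]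
    refine (measure_mono ?_).trans ((measure_union_le _ _).trans ((add_le_add (hb m)
      ((hb l).trans (pow_le_pow_of_le_one bot_le (by simp) hml))).trans_eq (two_mul _).symm))
    intro x hx
    obtain ⟨x, rfl⟩ := exists_loebPoint x
    have h1 := ge_of_tendsto (tendsto_dist_stdPart (b m) (b l) x)
      ((loebPoint_mem.1 hx).mono fun k hk => (mem_farSet.1 hk).le)
    by_contra hc
    simp only [Set.mem_union, Set.mem_ofPred_eq, not_or, not_le] at hc
    have h2 : (1 / 2 : ℝ) ^ l ≤ (1 / 2) ^ m :=
      pow_le_pow_of_le_one (by norm_num) (by norm_num) hml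
    linarith [dist_triangle_right (stdPart ω (b m) (loebPoint ω x))
      (stdPart ω (b l) (loebPoint ω x)) (F (loebPoint ω x))]
  have hlt : ∀ m : ℕ, 2 * (1 / 2 : ℝ≥0∞) ^ m < 3 * (1 / 2 : ℝ≥0∞) ^ m := fun m =>
    ENNReal.mul_lt_mul_left (hpow m).1 (hpow m).2 (by norm_num)
  -- Stage `k` will use the function of index `M k`, close to every earlier one. The limiting bound
  -- has constant `2`; the slack up to `3` makes it hold eventually.
  obtain ⟨M, hM, hM'⟩ := exists_diagonal hω
    (Q := fun l k => ∀ m ≤ l, ((farSet (b m k) (b l k) (2 * (1 / 2 : ℝ) ^ m)).card : ℝ≥0∞) / n k ≤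
      3 * (1 / 2 : ℝ≥0∞) ^ m)
    (fun l => (Set.finite_Iic l).eventually_all.2 fun m hm =>
      ((internalSize_tendsto _).eventually_lt_const ((hsize m l hm).trans_lt (hlt m))).mono
        fun _ h => h.le)
  refine ⟨fun k => b (M k) k, ?_⟩
  have hfar : ∀ m, loebMeasure ω n (internalSet ω fun k =>
      farSet (b m k) (b (M k) k) (2 * (1 / 2 : ℝ) ^ m)) ≤ 3 * (1 / 2 : ℝ≥0∞) ^ m := by
    intro m
    refine (loebMeasure_internalSet_le _).trans (internalSize_le_of_eventually ?_)
    filter_upwards [hM m, hM'] with k h1 h2 using h2 m h1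
  have hsum : ∑' m : ℕ, (1 / 2 : ℝ≥0∞) ^ m ≠ ∞ := by
    rw [ENNReal.tsum_geometric]
    simp
  -- Borel–Cantelli: almost every point lies in only finitely many of the exceptional sets.
  have h1 := ae_eventually_notMem (μ := loebMeasure ω n) (s := fun m => internalSet ω fun k =>
      farSet (b m k) (b (M k) k) (2 * (1 / 2 : ℝ) ^ m))
    (ne_top_of_le_ne_top (by rw [ENNReal.tsum_mul_left]; finiteness)
      (ENNReal.tsum_le_tsum hfar))
  have h2 := ae_eventually_notMem (ne_top_of_le_ne_top hsum (ENNReal.tsum_le_tsum hb))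
  filter_upwards [h1, h2] with x hx1 hx2
  obtain ⟨x, rfl⟩ := exists_loebPoint x
  have hlim : Tendsto (fun m : ℕ => 3 * (1 / 2 : ℝ) ^ m) atTop (𝓝 0) := by
    simpa using (tendsto_pow_atTop_nhds_zero_of_lt_one (r := (1 / 2 : ℝ)) (by norm_num)
      (by norm_num)).const_mul 3
  rw [← dist_le_zero]
  refine ge_of_tendsto hlim ((hx1.and hx2).mono fun m hm => ?_)
  obtain ⟨h3, h4⟩ := hm
  have h5 : dist (stdPart ω (b m) (loebPoint ω x))
      (stdPart ω (fun k => b (M k) k) (loebPoint ω x)) ≤ 2 * (1 / 2 : ℝ) ^ m := by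
    refine le_of_tendsto (tendsto_dist_stdPart (b m) (fun k => b (M k) k) x) ?_
    refine (Ultrafilter.eventually_not.2 h3).mono fun k hk => ?_
    simpa [mem_farSet] using hk
  simp only [not_le] at h4
  linarith [dist_triangle_left (stdPart ω (fun k => b (M k) k) (loebPoint ω x))
    (F (loebPoint ω x)) (stdPart ω (b m) (loebPoint ω x))]

/-- A measurable function is approximated in measure by continuous functions. -/
theorem exists_continuous_measure_dist_le {f : I → I} (hf : Measurable f) {ε : ℝ} (hε : 0 < ε)
    {δ : ℝ≥0∞} (hδ : δ ≠ 0) :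
    ∃ g : I → I, Continuous g ∧ volume {x | ε ≤ dist (g x) (f x)} ≤ δ := by
  have hF : Measurable fun x => (f x : ℝ) := measurable_subtype_coe.comp hf
  have hmem : MemLp (fun x => (f x : ℝ)) 1 volume :=
    MemLp.of_bound hF.aestronglyMeasurable 1 (Eventually.of_forall fun x => by
      rw [Real.norm_eq_abs, abs_of_nonneg (f x).2.1]
      exact (f x).2.2)
  have hε' : ENNReal.ofReal ε ≠ 0 := by simpa using hε
  -- An `L¹` error of `ε * δ` gives measure at most `δ` by Markov's inequality. Projecting `g` to
  -- the unit interval does not increase its distance to `f`.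
  obtain ⟨g, hg, -⟩ := hmem.exists_boundedContinuous_eLpNorm_sub_le ENNReal.one_ne_top
    (mul_ne_zero hε' hδ)
  refine ⟨fun x => Set.projIcc 0 1 zero_le_one (g x), continuous_projIcc.comp g.continuous, ?_⟩
  have h := meas_ge_le_mul_pow_eLpNorm_enorm (p := 1) volume one_ne_zero ENNReal.one_ne_top
    (hF.sub g.continuous.measurable).aestronglyMeasurable hε'
    (fun h => absurd h ENNReal.ofReal_ne_top)
  simp only [ENNReal.toReal_one, ENNReal.rpow_one] at h
  refine (measure_mono fun x hx => ?_).trans (h.trans ((mul_le_mul_right hg _).trans_eq ?_))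
  · have h1 : ε ≤ dist (g x) (f x) := by
      refine le_trans hx ?_
      have h2 : f x = Set.projIcc 0 1 zero_le_one (f x : ℝ) := (Set.projIcc_val _ _).symm
      rw [h2]
      conv_rhs => rw [← h2]
      exact Set.abs_projIcc_sub_projIcc zero_le_one
    change ENNReal.ofReal ε ≤ ‖(f x : ℝ) - g x‖ₑ
    rw [← ofReal_norm, ← dist_eq_norm, dist_comm]
    exact ENNReal.ofReal_le_ofReal h1
  · rw [← mul_assoc, ENNReal.inv_mul_cancel hε' ENNReal.ofReal_ne_top, one_mul]

/-- For continuous `g`, evaluation at grid points is an internal function with standard part `g ∘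
St`, and `St` transports the error estimates to the Loeb space. -/
theorem exists_internal_lifting_comp_St (hω : (ω : Filter ℕ) ≤ cofinite) (hpos : ∀ k, 0 < n k)
    (hn : Tendsto n atTop atTop) {f : I → I} (hf : Measurable f) :
    ∃ a : ∀ k, Fin (n k) → I, ∀ᵐ x ∂loebMeasure ω n, stdPart ω a x = f (St ω n x) := by
  choose g hg hg' using fun m : ℕ => exists_continuous_measure_dist_le hf
    (ε := (1 / 2 : ℝ) ^ m) (by positivity) (δ := (1 / 2 : ℝ≥0∞) ^ m) (pow_ne_zero _ (by simp))
  refine exists_internal_lifting hω hpos _ (fun m _ i => g m (gridPoint i)) fun m => ?_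
  simp only [stdPart_comp_gridPoint (hg m)]
  have hmeas : MeasurableSet {y | (1 / 2 : ℝ) ^ m ≤ dist (g m y) (f y)} :=
    measurableSet_le measurable_const ((hg m).measurable.dist hf)
  exact ((measurePreserving_St hω hpos hn).measure_preimage
    hmeas.nullMeasurableSet).trans_le (hg' m)

/-! ### Sorting an internal function -/

/-- The permutation that sends each index to its rank in the increasing order of the values. -/
noncomputable def rankPerm {m : ℕ} (a : Fin m → I) : Equiv.Perm (Fin m) :=
  (Tuple.sort a)⁻¹

theorem le_of_rankPerm_le {m : ℕ} (a : Fin m → I) {i j : Fin m}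
    (h : rankPerm a i ≤ rankPerm a j) : a i ≤ a j := by
  have := Tuple.monotone_sort a h
  simpa [rankPerm] using this

/-- Every index with value below `s` has smaller rank than `i`. With `rankPerm_lt_card_filter_le`
this brackets ranks by counts of values, regardless of how ties are broken. -/
theorem card_filter_lt_le_rankPerm {m : ℕ} (a : Fin m → I) {s : I} {i : Fin m} (h : s ≤ a i) :
    (Finset.univ.filter fun j => a j < s).card ≤ rankPerm a i := by
  rw [← Fin.card_Iio, ← Finset.card_map (rankPerm a).toEmbedding]
  refine Finset.card_le_card fun r hr => ?_
  obtain ⟨j, hj, rfl⟩ := Finset.mem_map.1 hr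
  rw [Finset.mem_filter_univ] at hj
  refine Finset.mem_Iio.2 (lt_of_not_ge fun hc => ?_)
  exact (hj.trans_le h).not_ge (le_of_rankPerm_le a hc)

theorem rankPerm_lt_card_filter_le {m : ℕ} (a : Fin m → I) {s : I} {i : Fin m} (h : a i ≤ s) :
    (rankPerm a i : ℕ) + 1 ≤ (Finset.univ.filter fun j => a j ≤ s).card := by
  rw [← Fin.card_Iic, ← Finset.card_map (rankPerm a)⁻¹.toEmbedding]
  refine Finset.card_le_card fun j hj => ?_
  obtain ⟨r, hr, rfl⟩ := Finset.mem_map.1 hj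
  rw [Finset.mem_Iic] at hr
  rw [Finset.mem_filter_univ]
  exact (le_of_rankPerm_le a (by simpa using hr)).trans h

theorem ofReal_gridPoint {m : ℕ} (i : Fin m) :
    ENNReal.ofReal (gridPoint i) = (((i : ℕ) + 1 : ℕ) : ℝ≥0∞) / m := by
  rw [gridPoint, ENNReal.ofReal_div_of_pos (by exact_mod_cast i.pos), ENNReal.ofReal_natCast]
  norm_cast

/-- If the standard part of `a` is uniformly distributed, then the ranks of the values of `a` have
the same standard part as `a`. -/
theorem St_act_rankPerm (hω : (ω : Filter ℕ) ≤ cofinite) (hpos : ∀ k, 0 < n k)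
    (a : ∀ k, Fin (n k) → I) (ha : MeasurePreserving (stdPart ω a) (loebMeasure ω n) volume)
    (x : LoebSpace ω n) : St ω n (act ω (fun k => rankPerm (a k)) x) = stdPart ω a x := by
  obtain ⟨x, rfl⟩ := exists_loebPoint x
  have hlim : Tendsto (fun k => (((rankPerm (a k) (x k) : ℕ) + 1 : ℕ) : ℝ≥0∞) / n k) ω
      (𝓝 (ENNReal.ofReal (St ω n (act ω (fun k => rankPerm (a k)) (loebPoint ω x))))) := by
    refine Tendsto.congr (fun k => ofReal_gridPoint _) ?_
    exact ((ENNReal.continuous_ofReal.comp continuous_subtype_val).tendsto _).comp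
      (tendsto_St fun k => rankPerm (a k) (x k))
  have hx := tendsto_stdPart (ω := ω) a x
  -- For `s` above the standard part, the rank is at most the count of `a ≤ s`, of limiting density
  -- at most `s`. For `s` below, it is at least the count of `a < s`, of limiting density at least
  -- `s`. The equality thus holds at every point.
  refine le_antisymm (le_of_forall_gt_imp_ge_of_dense fun s hs => ?_)
    (le_of_forall_lt_imp_le_of_dense fun s hs => ?_)
  · rw [← Subtype.coe_le_coe, ← ENNReal.ofReal_le_ofReal_iff s.2.1, ← unitInterval.volume_Iic s,
      ← ha.measure_preimage measurableSet_Iic.nullMeasurableSet]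
    refine le_trans ?_ (measure_mono (internalSet_le_subset a s))
    rw [loebMeasure_internalSet hω hpos]
    refine le_of_tendsto_of_tendsto hlim (internalSize_tendsto _) ?_
    filter_upwards [hx.eventually_lt_const hs] with k hk
    refine ENNReal.div_le_div_right ?_ _
    exact_mod_cast rankPerm_lt_card_filter_le (a k) hk.le
  · rw [← Subtype.coe_le_coe, ← ENNReal.ofReal_le_ofReal_iff (unitInterval.nonneg _),
      ← unitInterval.volume_Iio s, ← ha.measure_preimage measurableSet_Iio.nullMeasurableSet]
    refine (measure_mono (stdPart_lt_subset a s)).trans ?_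
    rw [loebMeasure_internalSet hω hpos]
    refine le_of_tendsto_of_tendsto (internalSize_tendsto _) hlim ?_
    filter_upwards [hx.eventually_const_lt hs] with k hk
    refine ENNReal.div_le_div_right ?_ _
    exact_mod_cast (card_filter_lt_le_rankPerm (a k) hk.le).trans (Nat.le_succ _)

/-- Sort an internal lifting of `φ ∘ St`, taken for a measurable representative of `φ`. The lifting
is uniformly distributed because `St` and `φ` preserve measure. -/
theorem exists_restrictsTo (hω : (ω : Filter ℕ) ≤ cofinite) (hpos : ∀ k, 0 < n k)
    (hn : Tendsto n atTop atTop) {φ : I → I} (hφ : AEMeasurable φ volume)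
    (hφ' : Measure.map φ volume = volume) : ∃ p : UniversalSoficGroup ω n, RestrictsTo p φ := by
  have hSt := measurePreserving_St hω hpos hn
  obtain ⟨a, ha⟩ := exists_internal_lifting_comp_St hω hpos hn hφ.measurable_mk
  have hmk : MeasurePreserving (hφ.mk φ) volume volume :=
    ⟨hφ.measurable_mk, by rw [← Measure.map_congr hφ.ae_eq_mk, hφ']⟩
  have hstd : MeasurePreserving (stdPart ω a) (loebMeasure ω n) volume :=
    ⟨measurable_stdPart a, by rw [Measure.map_congr ha]; exact (hmk.comp hSt).map_eq⟩
  refine ⟨QuotientGroup.mk fun k => rankPerm (a k), ?_⟩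
  change ∀ᵐ x ∂loebMeasure ω n, St ω n (act ω (fun k => rankPerm (a k)) x) = φ (St ω n x)
  filter_upwards [ha, hSt.quasiMeasurePreserving.ae hφ.ae_eq_mk] with x h1 h2
  rw [St_act_rankPerm hω hpos a hstd, h1, h2]

/-! ### The restriction homomorphism -/

/-- An identity at `St x` for almost all `x` descends to almost every point of the interval, as `St`
pushes the Loeb measure to `volume`. Measurable representatives make the set of equality measurable.
-/
theorem RestrictsTo.ae_eq {p : UniversalSoficGroup ω n} {φ ψ : I → I}
    (hSt : MeasurePreserving (St ω n) (loebMeasure ω n) volume)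
    (hφ : AEMeasurable φ volume) (hψ : AEMeasurable ψ volume) (h : RestrictsTo p φ)
    (h' : RestrictsTo p ψ) : ∀ᵐ x, φ x = ψ x := by
  induction p using QuotientGroup.induction_on with | H p =>
  change ∀ᵐ x ∂loebMeasure ω n, St ω n (act ω p x) = φ (St ω n x) at h
  change ∀ᵐ x ∂loebMeasure ω n, St ω n (act ω p x) = ψ (St ω n x) at h'
  have hmk : ∀ᵐ x, hφ.mk φ x = hψ.mk ψ x := by
    have hmap := ae_map_iff (μ := loebMeasure ω n) hSt.measurable.aemeasurable
      (measurableSet_eq_fun hφ.measurable_mk hψ.measurable_mk)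
    rw [hSt.map_eq] at hmap
    refine hmap.2 ?_
    filter_upwards [h, h', hSt.quasiMeasurePreserving.ae hφ.ae_eq_mk,
      hSt.quasiMeasurePreserving.ae hψ.ae_eq_mk] with x h1 h2 h3 h4
    rw [← h3, ← h4, ← h1, h2]
  filter_upwards [hmk, hφ.ae_eq_mk, hψ.ae_eq_mk] with x h1 h2 h3
  rw [h2, h3, h1]

theorem RestrictsTo.congr {p : UniversalSoficGroup ω n} {φ ψ : I → I}
    (hSt : MeasurePreserving (St ω n) (loebMeasure ω n) volume)
    (h : RestrictsTo p φ) (hφψ : ∀ᵐ x, φ x = ψ x) : RestrictsTo p ψ := by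
  induction p using QuotientGroup.induction_on with | H p =>
  change ∀ᵐ x ∂loebMeasure ω n, St ω n (act ω p x) = φ (St ω n x) at h
  change ∀ᵐ x ∂loebMeasure ω n, St ω n (act ω p x) = ψ (St ω n x)
  filter_upwards [h, hSt.quasiMeasurePreserving.ae hφψ] with x h1 h2
  rw [h1, h2]

theorem RestrictsTo.mul {p q : UniversalSoficGroup ω n} {φ ψ : I → I}
    (hp : RestrictsTo p φ) (hq : RestrictsTo q ψ) : RestrictsTo (p * q) (φ ∘ ψ) := by
  induction p using QuotientGroup.induction_on with | H p =>
  induction q using QuotientGroup.induction_on with | H q =>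
  change ∀ᵐ x ∂loebMeasure ω n, St ω n (act ω p x) = φ (St ω n x) at hp
  change ∀ᵐ x ∂loebMeasure ω n, St ω n (act ω q x) = ψ (St ω n x) at hq
  change ∀ᵐ x ∂loebMeasure ω n, St ω n (act ω (p * q) x) = φ (ψ (St ω n x))
  -- The relation for `p` is needed at `act ω q x`; its exceptional set pulls back to a null set.
  filter_upwards [hq, (quasiMeasurePreserving_act q).ae hp] with x h1 h2
  rw [act_mul, h2, h1]

theorem coxeterSemilength_eq_zero_iff (hω : (ω : Filter ℕ) ≤ cofinite) (hpos : ∀ k, 0 < n k)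
    (p : UniversalSoficGroup ω n) :
    coxeterSemilength p = 0 ↔ RestrictsTo p ((1 : measureAut) : Equiv.Perm I) := by
  induction p using QuotientGroup.induction_on with | H p =>
  exact ulim_coxeterLength_eq_zero_iff hω hpos p

theorem ellZero_le_GA (hω : (ω : Filter ℕ) ≤ cofinite) (hpos : ∀ k, 0 < n k) :
    ellZero ω n ≤ GA ω n :=
  fun p hp => ⟨1, (coxeterSemilength_eq_zero_iff hω hpos p).1 hp⟩

theorem measureAut_mk_eq_iff {S T : measureAut} :
    (S : Aut) = (T : Aut) ↔ ∀ᵐ x, (S : Equiv.Perm I) x = (T : Equiv.Perm I) x := by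
  rw [QuotientGroup.eq]
  change (∀ᵐ x, (S : Equiv.Perm I)⁻¹ ((T : Equiv.Perm I) x) = x) ↔ _
  refine eventually_congr (Eventually.of_forall fun x => ?_)
  rw [Equiv.Perm.inv_eq_iff_eq, eq_comm]

theorem RestrictsTo.mk_eq_iff {p : UniversalSoficGroup ω n} {S T : measureAut}
    (hSt : MeasurePreserving (St ω n) (loebMeasure ω n) volume)
    (hS : RestrictsTo p (S : Equiv.Perm I)) :
    (S : Aut) = (T : Aut) ↔ RestrictsTo p (T : Equiv.Perm I) := by
  rw [measureAut_mk_eq_iff]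
  exact ⟨hS.congr hSt, hS.ae_eq hSt S.2.1.1 T.2.1.1⟩

/-- The restriction homomorphism `𝒢𝒜 → Aut(X, μ)`. -/
noncomputable def restriction
    (hSt : MeasurePreserving (St ω n) (loebMeasure ω n) volume) : GA ω n →* Aut :=
  -- The class of the chosen automorphism does not depend on the choice, by `RestrictsTo.mk_eq_iff`;
  -- multiplicativity follows because the product of the choices is admissible for `p * q`.
  MonoidHom.mk' (fun p => (p.2.choose : Aut)) fun p q => by
    have h : RestrictsTo ((p * q : GA ω n) : UniversalSoficGroup ω n)
        ((p.2.choose * q.2.choose : measureAut) : Equiv.Perm I) :=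
      p.2.choose_spec.mul q.2.choose_spec
    exact ((p * q).2.choose_spec.mk_eq_iff hSt).2 h

theorem restriction_eq_iff (hSt : MeasurePreserving (St ω n) (loebMeasure ω n) volume)
    (p : GA ω n) (T : measureAut) : restriction hSt p = (T : Aut) ↔
      RestrictsTo (p : UniversalSoficGroup ω n) (T : Equiv.Perm I) :=
  p.2.choose_spec.mk_eq_iff hSt

end Sofic


/-! ### The short exact sequence -/

theorem mainTheorem3 (ω : Ultrafilter ℕ) (hω : (ω : Filter ℕ) ≤ Filter.cofinite)
    (n : ℕ → ℕ) (hpos : ∀ k, 0 < n k) (hmono : Monotone n)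
    (hn : Filter.Tendsto n Filter.atTop Filter.atTop) :
    ∃ (hle : Sofic.ellZero ω n ≤ Sofic.GA ω n) (Ψ : Sofic.GA ω n →* Sofic.Aut),
      (∀ (p : Sofic.GA ω n) (T : Sofic.measureAut),
        Ψ p = (T : Sofic.Aut) ↔
          Sofic.RestrictsTo (p : Sofic.UniversalSoficGroup ω n) (T : Equiv.Perm unitInterval)) ∧
      Function.Injective (Subgroup.inclusion hle) ∧
      (Subgroup.inclusion hle).range = Ψ.ker ∧
      Function.Surjective Ψ := by
  have hSt := Sofic.measurePreserving_St hω hpos hn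
  have hle := Sofic.ellZero_le_GA hω hpos
  refine ⟨hle, Sofic.restriction hSt, Sofic.restriction_eq_iff hSt,
    Subgroup.inclusion_injective hle, ?_, ?_⟩
  · ext p
    -- Being in the kernel means restricting to the identity, which is semi-length zero.
    have h : p ∈ (Sofic.restriction hSt).ker ↔ (p : Sofic.UniversalSoficGroup ω n) ∈
        Sofic.ellZero ω n :=
      (Sofic.restriction_eq_iff hSt p 1).trans
        (Sofic.coxeterSemilength_eq_zero_iff hω hpos _).symm
    rw [h]
    constructor
    · rintro ⟨q, rfl⟩
      exact q.2
    · exact fun hp => ⟨⟨p, hp⟩, rfl⟩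
  · intro T
    induction T using QuotientGroup.induction_on with | H T =>
    obtain ⟨p, hp⟩ := Sofic.exists_restrictsTo hω hpos hn T.2.1.1 T.2.1.2
    exact ⟨⟨p, T, hp⟩, (Sofic.restriction_eq_iff hSt _ T).2 hp⟩
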